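/- Let $$s_{\mu,\nu}(z)=\frac{z^{\mu+1}}{(\mu+1)^2-\nu^2}\,{}_1F_2\!\left(1;\frac{\mu-\nu+3}{2},\frac{\mu+\nu+3}{2};-\frac{z^2}{4}\right)$$ be the Lommel function, where ${}_1F_2(\alpha;\beta,\gamma;z)=\sum_{k\ge0}\frac{(\alpha)_k}{(\beta)_k(\gamma)_k}\frac{z^k}{k!}$ and $(q)_k=q(q+1)\cdots(q+k-1)$. Let $J_0(x)=\sum_{k\ge0}\frac{(-1)^k}{(k!)^2}\left(\frac x2\right)^{2k}$ be the Bessel function and $\mathbf H_0(x)=\sum_{k\ge0}\frac{(-1)^k}{\Gamma(k+3/2)^2}\left(\frac x2\right)^{2k+1}$ the Struve function of order zero. Then for all real $a,b$ the following integrals converge absolutely and have the stated values (for $\mu\in\{-1,0\}$ the factor $z^{\mu+1}$ is $1$ or $z$; the integrands are defined for all $x>0$ outside a set of isolated integers): (a) $\displaystyle\int_0^\infty x\sin(\pi x)\,s_{-1,x}(a)\,s_{0,x}(b)\,dx=\frac{\pi^2}{4}\bigl[\mathbf H_0(a-b)-\mathbf H_0(a+b)\bigr]$; (a′) $\displaystyle\int_0^\infty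 x\sin(\pi x)\,s_{-1,x}(a)\,s_{0,x}(a)\,dx=-\frac{\pi^2}{4}\mathbf H_0(2a)$; (b) $\displaystyle\int_0^\infty \cos^2(\pi x/2)\,s_{0,x}(a)\,s_{0,x}(b)\,dx=\frac{\pi^2}{8}\bigl[J_0(|a-b|)-J_0(a+b)\bigr]$; (b′) $\displaystyle\int_0^\infty \cos^2(\pi x/2)\,s_{0,x}(a)^2\,dx=\frac{\pi^2}{8}\bigl[1-J_0(2a)\bigr]$; (c) $\displaystyle\int_0^\infty x^2\sin^2(\pi x/2)\,s_{-1,x}(a)\,s_{-1,x}(b)\,dx=\frac{\pi^2}{8}\bigl[J_0(|a-b|)+J_0(a+b)\bigr]$; (c′) $\displaystyle\int_0^\infty x^2\sin^2(\pi x/2)\,s_{-1,x}(a)^2\,dx=\frac{\pi^2}{8}\bigl[1+J_0(2a)\bigr]$. -/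

import Mathlib

open MeasureTheory Set
open scoped Nat

noncomputable section

/-- The hypergeometric function `₁F₂(a; b, c; z) = ∑ₖ (a)ₖ / ((b)ₖ (c)ₖ) * zᵏ / k!`, where `(q)ₖ` is
the rising factorial. The series converges for all real `z` as long as neither `b` nor `c` is a
non-positive integer. -/
def hyp1F2 (a b c z : ℝ) : ℝ :=
  ∑' k : ℕ, (ascPochhammer ℝ k).eval a /
    ((ascPochhammer ℝ k).eval b * (ascPochhammer ℝ k).eval c) * (z ^ k / (k ! : ℝ))

/-- The Lommel function `s_{μ,ν}(z)` of a real argument. It is meaningful unless `μ + ν` or `μ - ν`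
is a negative odd integer. The power is a real power, with `z ^ 0 = 1` and `z ^ 1 = z` for every
real `z`; so for `μ = -1` and `μ = 0` this is the usual function for arguments of either sign. -/
def lommelS (μ ν z : ℝ) : ℝ :=
  z ^ (μ + 1) / ((μ + 1) ^ 2 - ν ^ 2) *
    hyp1F2 1 ((μ - ν + 3) / 2) ((μ + ν + 3) / 2) (-(z ^ 2 / 4))

/-- The Bessel function of the first kind of order zero,
`J₀(x) = ∑ₖ (-1)ᵏ / (k!)² * (x / 2)^(2k)`. -/
def besselJ0 (x : ℝ) : ℝ :=
  ∑' k : ℕ, (-1 : ℝ) ^ k / (k ! : ℝ) ^ 2 * (x / 2) ^ (2 * k)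

/-- The Struve function of order zero,
`H₀(x) = ∑ₖ (-1)ᵏ / Γ(k + 3/2)² * (x / 2)^(2k+1)`. -/
def struveH0 (x : ℝ) : ℝ :=
  ∑' k : ℕ, (-1 : ℝ) ^ k / Real.Gamma ((k : ℝ) + 3 / 2) ^ 2 * (x / 2) ^ (2 * k + 1)

end

/-!
The integrals are instances of Parseval's identity. For a function `f` on `[-π/2, π/2]` consider the
cosine transform `ν ↦ ∫ cos (ν θ) f θ dθ`. Expanding `cos (a cos θ)` and `sin (b cos θ)` in powers of
`cos θ` and using the recurrence `((n+2)² - ν²) Iₙ₊₂ = (n+2)(n+1) Iₙ` for the moments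
`Iₙ = ∫ cos (ν θ) cosⁿ θ dθ` gives, for every `ν` that is not an integer,

* `∫ cos (ν θ) cos (a cos θ) dθ = -2 ν sin (π ν / 2) s_{-1,ν}(a)` (`cosTransform_cos_mul_cos`),
* `∫ cos (ν θ) sin (b cos θ) dθ = 2 cos (π ν / 2) s_{0,ν}(b)` (`cosTransform_sin_mul_cos`).

The cosine transforms are Fourier transforms of even functions in `L¹ ∩ L²`, so by Plancherel the
product of two of them is integrable, with integral over `(0, ∞)` equal to `π ∫ f g`
(`integral_cosTransform_mul_cosTransform`). Since the integers are a null set, each integrand of the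
theorem is almost everywhere a multiple of such a product. The remaining integrals of
`cos (x cos θ)` and `sin (x cos θ)`, which appear after a product-to-sum formula, are `π J₀(x)` and
`π H₀(x)` (`integral_cos_mul_cos`, `integral_sin_mul_cos`) by the same expansion at `ν = 0`.
-/

/-! ### Parseval's identity for the cosine transform -/

open FourierTransform in
/-- On `L¹ ∩ L²` the Plancherel extension of the Fourier transform agrees almost everywhere with the
Fourier integral: both pair in the same way with smooth compactly supported functions. -/
theorem fourier_toLp_ae_eq {f : ℝ → ℂ} (hf : Integrable f) (hf2 : MemLp f 2) :
    ((𝓕 (hf2.toLp f) : Lp ℂ 2 (volume : Measure ℝ)) : ℝ → ℂ) =ᵐ[volume] 𝓕 f := by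
  have hcont : Continuous (𝓕 f) :=
    VectorFourier.fourierIntegral_continuous Real.continuous_fourierChar
      (by exact continuous_inner) hf
  refine ae_eq_of_integral_contDiff_smul_eq
    ((Lp.memLp _).locallyIntegrable (by norm_num)) hcont.locallyIntegrable ?_
  intro g hg hgc
  have hgc' : HasCompactSupport (fun x => (g x : ℂ)) := hgc.comp_left (g := Complex.ofReal) rfl
  have hg' : ContDiff ℝ (⊤ : ℕ∞) (fun x => (g x : ℂ)) := Complex.ofRealCLM.contDiff.comp hg
  let u : SchwartzMap ℝ ℂ := hgc'.toSchwartzMap hg'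
  have h1 : ∀ h : ℝ → ℂ, ∫ x, g x • h x = ∫ x, u x • h x := fun h => by
    refine integral_congr_ae (.of_forall fun x => ?_)
    simp [u]
  rw [h1, h1, ← Lp.toTemperedDistribution_apply, ← Lp.fourier_toTemperedDistribution_eq,
    TemperedDistribution.fourier_apply, Lp.toTemperedDistribution_apply]
  have h2 : ∫ x, (𝓕 u) x • (hf2.toLp f) x = ∫ x, (𝓕 u) x • f x := by
    refine integral_congr_ae ?_
    filter_upwards [hf2.coeFn_toLp] with x hx
    rw [hx]
  rw [h2]
  have h3 := VectorFourier.integral_fourierIntegral_smul_eq_flip (L := innerₗ ℝ)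
    Real.continuous_fourierChar continuous_inner (u.integrable (μ := volume)) hf
  rw [flip_innerₗ] at h3
  exact h3

open FourierTransform ComplexConjugate in
/-- Parseval's identity for Fourier integrals of functions in `L¹ ∩ L²`. -/
theorem integral_conj_fourier_mul_fourier {f g : ℝ → ℂ} (hf : Integrable f) (hf2 : MemLp f 2)
    (hg : Integrable g) (hg2 : MemLp g 2) :
    Integrable (fun x => conj (𝓕 f x) * 𝓕 g x) ∧
      ∫ x, conj (𝓕 f x) * 𝓕 g x = ∫ x, conj (f x) * g x := by
  have key := Lp.inner_fourier_eq (hf2.toLp f) (hg2.toLp g)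
  have hint := L2.integrable_inner (𝕜 := ℂ) (𝓕 (hf2.toLp f)) (𝓕 (hg2.toLp g))
  rw [L2.inner_def, L2.inner_def] at key
  have e1 : (fun x => inner ℂ ((𝓕 (hf2.toLp f) : Lp ℂ 2 (volume : Measure ℝ)) x)
      ((𝓕 (hg2.toLp g) : Lp ℂ 2 (volume : Measure ℝ)) x)) =ᵐ[volume]
      fun x => conj (𝓕 f x) * 𝓕 g x := by
    filter_upwards [fourier_toLp_ae_eq hf hf2, fourier_toLp_ae_eq hg hg2] with x h1 h2
    rw [h1, h2, RCLike.inner_apply, mul_comm]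
  have e2 : (fun x => inner ℂ ((hf2.toLp f) x) ((hg2.toLp g) x)) =ᵐ[volume]
      fun x => conj (f x) * g x := by
    filter_upwards [hf2.coeFn_toLp, hg2.coeFn_toLp] with x h1 h2
    rw [h1, h2, RCLike.inner_apply, mul_comm]
  refine ⟨hint.congr e1, ?_⟩
  rw [← integral_congr_ae e1, ← integral_congr_ae e2, key]

/-- The cosine transform `ν ↦ ∫ cos (ν θ) f θ dθ` of a function restricted to `[-π/2, π/2]`. -/
noncomputable def cosTransform (f : ℝ → ℝ) (ν : ℝ) : ℝ :=
  ∫ θ in (-(Real.pi / 2))..(Real.pi / 2), Real.cos (ν * θ) * f θ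

theorem neg_half_pi_le : -(Real.pi / 2) ≤ Real.pi / 2 := by linarith [Real.pi_pos]

theorem cosTransform_neg (f : ℝ → ℝ) (ν : ℝ) : cosTransform f (-ν) = cosTransform f ν := by
  simp [cosTransform]

open FourierTransform in
theorem fourier_indicator_eq_cosTransform {f : ℝ → ℝ} (hf : Continuous f)
    (heven : ∀ θ, f (-θ) = f θ) (ξ : ℝ) :
    𝓕 ((Ioc (-(Real.pi / 2)) (Real.pi / 2)).indicator fun θ => (f θ : ℂ)) ξ =
      (cosTransform f (2 * Real.pi * ξ) : ℂ) := by
  rw [Real.fourier_real_eq_integral_exp_smul]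
  have h1 : (fun v : ℝ => Complex.exp (↑(-2 * Real.pi * v * ξ) * Complex.I) •
      (Ioc (-(Real.pi / 2)) (Real.pi / 2)).indicator (fun θ => (f θ : ℂ)) v) =
      (Ioc (-(Real.pi / 2)) (Real.pi / 2)).indicator
        (fun v => ((Real.cos (2 * Real.pi * ξ * v) * f v : ℝ) : ℂ) -
          ((Real.sin (2 * Real.pi * ξ * v) * f v : ℝ) : ℂ) * Complex.I) := by
    ext v
    by_cases hv : v ∈ Ioc (-(Real.pi / 2)) (Real.pi / 2)
    · rw [indicator_of_mem hv, indicator_of_mem hv, Complex.exp_mul_I, ← Complex.ofReal_cos,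
        ← Complex.ofReal_sin, show -2 * Real.pi * v * ξ = -(2 * Real.pi * ξ * v) by ring,
        Real.cos_neg, Real.sin_neg, smul_eq_mul]
      push_cast
      ring
    · simp [hv]
  rw [h1, integral_indicator measurableSet_Ioc,
    ← intervalIntegral.integral_of_le neg_half_pi_le, intervalIntegral.integral_sub
      (Continuous.intervalIntegrable (by fun_prop) _ _)
      (Continuous.intervalIntegrable (by fun_prop) _ _),
    intervalIntegral.integral_mul_const, intervalIntegral.integral_ofReal,
    intervalIntegral.integral_ofReal]
  -- The sine part is the integral of an odd function.
  have h2 : ∫ v in (-(Real.pi / 2))..(Real.pi / 2), Real.sin (2 * Real.pi * ξ * v) * f v = 0 := by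
    have := intervalIntegral.integral_comp_neg (a := -(Real.pi / 2)) (b := Real.pi / 2)
      (fun v => Real.sin (2 * Real.pi * ξ * v) * f v)
    simp only [mul_neg, Real.sin_neg, heven, neg_mul, neg_neg,
      intervalIntegral.integral_neg] at this
    linarith
  rw [h2, cosTransform]
  simp

/-- Parseval's identity for the cosine transform of even continuous functions on `[-π/2, π/2]`,
including the absolute convergence of the left-hand side. -/
theorem integral_cosTransform_mul_cosTransform {f g : ℝ → ℝ} (hf : Continuous f)
    (hg : Continuous g) (hfe : ∀ θ, f (-θ) = f θ) (hge : ∀ θ, g (-θ) = g θ) :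
    IntegrableOn (fun ν => cosTransform f ν * cosTransform g ν) (Ioi 0) ∧
      ∫ ν in Ioi (0 : ℝ), cosTransform f ν * cosTransform g ν =
        Real.pi * ∫ θ in (-(Real.pi / 2))..(Real.pi / 2), f θ * g θ := by
  have hI : ∀ {h : ℝ → ℝ}, Continuous h → ∀ p : ENNReal,
      MemLp ((Ioc (-(Real.pi / 2)) (Real.pi / 2)).indicator fun θ => (h θ : ℂ)) p := by
    intro h hh p
    rw [memLp_indicator_iff_restrict measurableSet_Ioc]
    have hc : Continuous fun θ => (h θ : ℂ) := by fun_prop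
    obtain ⟨C, hC⟩ := isCompact_Icc.exists_bound_of_continuousOn
      (s := Icc (-(Real.pi / 2)) (Real.pi / 2)) hc.continuousOn
    refine MemLp.of_bound hc.aestronglyMeasurable C ?_
    exact (ae_restrict_iff' measurableSet_Ioc).2
      (.of_forall fun x hx => hC x (Ioc_subset_Icc_self hx))
  obtain ⟨h1, h2⟩ := integral_conj_fourier_mul_fourier
    (memLp_one_iff_integrable.1 (hI hf 1)) (hI hf 2)
    (memLp_one_iff_integrable.1 (hI hg 1)) (hI hg 2)
  simp only [fourier_indicator_eq_cosTransform hf hfe, fourier_indicator_eq_cosTransform hg hge,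
    Complex.conj_ofReal, ← Complex.ofReal_mul] at h1 h2
  have h1' : Integrable fun x => cosTransform f (2 * Real.pi * x) *
      cosTransform g (2 * Real.pi * x) := by simpa using h1.re
  have hpi : (2 * Real.pi) ≠ 0 := by positivity
  have h3 : Integrable fun ν => cosTransform f ν * cosTransform g ν :=
    (integrable_comp_mul_left_iff (fun ν => cosTransform f ν * cosTransform g ν) hpi).1 h1'
  refine ⟨h3.integrableOn, ?_⟩
  -- Mathlib's Fourier transform has frequency variable `ξ`, with `ν = 2πξ`.
  have h4 : ∫ x, cosTransform f (2 * Real.pi * x) * cosTransform g (2 * Real.pi * x) =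
      ∫ θ in (-(Real.pi / 2))..(Real.pi / 2), f θ * g θ := by
    rw [integral_complex_ofReal] at h2
    rw [intervalIntegral.integral_of_le neg_half_pi_le, ← integral_indicator measurableSet_Ioc]
    apply Complex.ofReal_injective
    rw [h2, ← integral_complex_ofReal]
    refine integral_congr_ae (.of_forall fun x => ?_)
    by_cases hx : x ∈ Ioc (-(Real.pi / 2)) (Real.pi / 2) <;> simp [hx]
  rw [Measure.integral_comp_mul_left (fun ν => cosTransform f ν * cosTransform g ν)] at h4
  -- The product is even in `ν`, so the half-line carries half of the integral.
  have h5 : ∀ ν, cosTransform f |ν| * cosTransform g |ν| =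
      cosTransform f ν * cosTransform g ν := fun ν => by
    rcases abs_choice ν with h | h <;> rw [h]
    rw [cosTransform_neg, cosTransform_neg]
  have h6 := integral_comp_abs (f := fun ν => cosTransform f ν * cosTransform g ν)
  simp only [h5] at h6
  rw [h6, abs_of_pos (by positivity), smul_eq_mul] at h4
  rw [← h4]
  field_simp

/-! ### Moments of powers of the cosine -/

/-- Recurrence between the moments of `cos ^ n`, obtained by integrating
`cos (ν θ) * P'' + ν ^ 2 * cos (ν θ) * P` by parts for `P = cos ^ (n + 2)`; the boundary terms vanish
because `cos` vanishes at `±π/2`. -/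
theorem cosTransform_cos_pow_add_two (n : ℕ) (ν : ℝ) :
    (((n : ℝ) + 2) ^ 2 - ν ^ 2) * cosTransform (fun θ => Real.cos θ ^ (n + 2)) ν =
      ((n : ℝ) + 2) * (n + 1) * cosTransform (fun θ => Real.cos θ ^ n) ν := by
  have hW : ∀ θ : ℝ, HasDerivAt
      (fun θ => ((n : ℝ) + 2) * (Real.cos θ ^ (n + 1) * -Real.sin θ) * Real.cos (ν * θ) +
        ν * (Real.cos θ ^ (n + 2) * Real.sin (ν * θ)))
      (((n : ℝ) + 2) * (n + 1) * (Real.cos (ν * θ) * Real.cos θ ^ n) -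
        (((n : ℝ) + 2) ^ 2 - ν ^ 2) * (Real.cos (ν * θ) * Real.cos θ ^ (n + 2))) θ := by
    intro θ
    have hlin : HasDerivAt (fun θ => ν * θ) ν θ := by
      simpa using (hasDerivAt_id θ).const_mul ν
    have hc := Real.hasDerivAt_cos θ
    have h := ((((hc.pow (n + 1)).mul (Real.hasDerivAt_sin θ).neg).const_mul
      ((n : ℝ) + 2)).mul hlin.cos).add (((hc.pow (n + 2)).mul hlin.sin).const_mul ν)
    refine h.congr_deriv ?_
    have hs : Real.sin θ ^ 2 = 1 - Real.cos θ ^ 2 := Real.sin_sq θ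
    simp only [Nat.add_sub_cancel, Pi.mul_apply, Pi.neg_apply, Pi.pow_apply,
      show n + 2 - 1 = n + 1 by omega]
    push_cast
    linear_combination (((n : ℝ) + 2) * (n + 1) * Real.cos θ ^ n * Real.cos (ν * θ)) * hs
  have hint := intervalIntegral.integral_eq_sub_of_hasDerivAt
    (a := -(Real.pi / 2)) (b := Real.pi / 2) (fun θ _ => hW θ)
    (Continuous.intervalIntegrable (by fun_prop) _ _)
  rw [intervalIntegral.integral_sub (Continuous.intervalIntegrable (by fun_prop) _ _)
      (Continuous.intervalIntegrable (by fun_prop) _ _), intervalIntegral.integral_const_mul,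
    intervalIntegral.integral_const_mul] at hint
  simp only [Real.cos_neg, Real.cos_pi_div_two, ne_eq, Nat.add_eq_zero_iff, OfNat.ofNat_ne_zero,
    one_ne_zero, and_false, not_false_eq_true, zero_pow, zero_mul, mul_zero, add_zero,
    sub_zero] at hint
  simp only [cosTransform]
  linarith

theorem mul_cosTransform_cos_pow_zero (ν : ℝ) :
    ν * cosTransform (fun θ => Real.cos θ ^ 0) ν = 2 * Real.sin (Real.pi * ν / 2) := by
  have hW : ∀ θ : ℝ, HasDerivAt (fun θ => Real.sin (ν * θ))
      (ν * (Real.cos (ν * θ) * Real.cos θ ^ 0)) θ := by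
    intro θ
    have hlin : HasDerivAt (fun θ => ν * θ) ν θ := by
      simpa using (hasDerivAt_id θ).const_mul ν
    exact hlin.sin.congr_deriv (by ring)
  have hint := intervalIntegral.integral_eq_sub_of_hasDerivAt
    (a := -(Real.pi / 2)) (b := Real.pi / 2) (fun θ _ => hW θ)
    (Continuous.intervalIntegrable (by fun_prop) _ _)
  rw [intervalIntegral.integral_const_mul] at hint
  rw [cosTransform, hint, mul_neg, Real.sin_neg, show ν * (Real.pi / 2) = Real.pi * ν / 2 by ring]
  ring

theorem mul_cosTransform_cos_pow_one (ν : ℝ) :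
    (1 - ν ^ 2) * cosTransform (fun θ => Real.cos θ ^ 1) ν = 2 * Real.cos (Real.pi * ν / 2) := by
  -- The antiderivative comes from two integrations by parts of `cos (ν θ) * cos θ`.
  have hW : ∀ θ : ℝ, HasDerivAt
      (fun θ => Real.sin θ * Real.cos (ν * θ) - ν * (Real.cos θ * Real.sin (ν * θ)))
      ((1 - ν ^ 2) * (Real.cos (ν * θ) * Real.cos θ ^ 1)) θ := by
    intro θ
    have hlin : HasDerivAt (fun θ => ν * θ) ν θ := by
      simpa using (hasDerivAt_id θ).const_mul ν
    have h := ((Real.hasDerivAt_sin θ).mul hlin.cos).sub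
      (((Real.hasDerivAt_cos θ).mul hlin.sin).const_mul ν)
    exact h.congr_deriv (by ring)
  have hint := intervalIntegral.integral_eq_sub_of_hasDerivAt
    (a := -(Real.pi / 2)) (b := Real.pi / 2) (fun θ _ => hW θ)
    (Continuous.intervalIntegrable (by fun_prop) _ _)
  rw [intervalIntegral.integral_const_mul] at hint
  rw [cosTransform, hint, mul_neg, Real.sin_neg, Real.sin_neg, Real.cos_neg, Real.cos_neg,
    Real.cos_pi_div_two, Real.sin_pi_div_two, show ν * (Real.pi / 2) = Real.pi * ν / 2 by ring]
  ring

/-- Closed form of the even moments: the recurrence contributes the factors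
`(2j) ^ 2 - ν ^ 2 = 4 (j - ν/2) (j + ν/2)`, whose product is a product of two rising factorials. -/
theorem ascPochhammer_mul_cosTransform_cos_pow_even (ν : ℝ) (k : ℕ) :
    4 ^ k * ((ascPochhammer ℝ k).eval (1 - ν / 2) * (ascPochhammer ℝ k).eval (1 + ν / 2)) *
        cosTransform (fun θ => Real.cos θ ^ (2 * k)) ν =
      ((2 * k)! : ℝ) * cosTransform (fun θ => Real.cos θ ^ 0) ν := by
  induction k with
  | zero => simp
  | succ k ih =>
    have h := cosTransform_cos_pow_add_two (2 * k) ν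
    rw [ascPochhammer_succ_eval, ascPochhammer_succ_eval, show 2 * (k + 1) = 2 * k + 2 by ring,
      Nat.factorial_succ, Nat.factorial_succ]
    push_cast at h ⊢
    linear_combination (2 * (k : ℝ) + 2) * (2 * k + 1) * ih +
      4 ^ k * ((ascPochhammer ℝ k).eval (1 - ν / 2) * (ascPochhammer ℝ k).eval (1 + ν / 2)) * h

/-- Closed form of the odd moments: the recurrence contributes the factors
`(2j + 1) ^ 2 - ν ^ 2`, whose product is a product of two rising factorials. -/
theorem ascPochhammer_mul_cosTransform_cos_pow_odd (ν : ℝ) (k : ℕ) :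
    4 ^ k * ((ascPochhammer ℝ k).eval ((3 - ν) / 2) * (ascPochhammer ℝ k).eval ((3 + ν) / 2)) *
        cosTransform (fun θ => Real.cos θ ^ (2 * k + 1)) ν =
      ((2 * k + 1)! : ℝ) * cosTransform (fun θ => Real.cos θ ^ 1) ν := by
  induction k with
  | zero => simp
  | succ k ih =>
    have h := cosTransform_cos_pow_add_two (2 * k + 1) ν
    rw [ascPochhammer_succ_eval, ascPochhammer_succ_eval,
      show 2 * (k + 1) + 1 = 2 * k + 1 + 2 by ring,
      Nat.factorial_succ (2 * k + 1 + 1), Nat.factorial_succ (2 * k + 1)]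
    push_cast at h ⊢
    linear_combination (2 * (k : ℝ) + 3) * (2 * k + 2) * ih +
      4 ^ k * ((ascPochhammer ℝ k).eval ((3 - ν) / 2) *
        (ascPochhammer ℝ k).eval ((3 + ν) / 2)) * h

/-! ### Lommel functions as cosine transforms -/

/-- Term by term integration of a power series in `cos θ`. -/
theorem hasSum_cosTransform {c : ℕ → ℝ} {e : ℕ → ℕ} {f : ℝ → ℝ} (hc : Summable fun k => |c k|)
    (hf : ∀ θ, HasSum (fun k => c k * Real.cos θ ^ e k) (f θ)) (ν : ℝ) :
    HasSum (fun k => c k * cosTransform (fun θ => Real.cos θ ^ e k) ν) (cosTransform f ν) := by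
  have h := intervalIntegral.hasSum_integral_of_dominated_convergence
    (a := -(Real.pi / 2)) (b := Real.pi / 2) (μ := volume)
    (F := fun k θ => Real.cos (ν * θ) * (c k * Real.cos θ ^ e k))
    (f := fun θ => Real.cos (ν * θ) * f θ) (fun k _ => |c k|)
    (fun k => Continuous.aestronglyMeasurable (by fun_prop))
    (fun k => .of_forall fun θ _ => ?_)
    (.of_forall fun θ _ => hc) intervalIntegrable_const
    (.of_forall fun θ _ => (hf θ).mul_left _)
  · have hk : ∀ k, c k * cosTransform (fun θ => Real.cos θ ^ e k) ν =
        ∫ θ in (-(Real.pi / 2))..(Real.pi / 2), Real.cos (ν * θ) * (c k * Real.cos θ ^ e k) := by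
      intro k
      rw [cosTransform, ← intervalIntegral.integral_const_mul]
      congr 1
      ext θ
      ring
    simp_rw [hk]
    exact h
  · rw [Real.norm_eq_abs, abs_mul, abs_mul, abs_pow]
    have h1 := Real.abs_cos_le_one (ν * θ)
    have h2 : |Real.cos θ| ^ e k ≤ 1 := pow_le_one₀ (abs_nonneg _) (Real.abs_cos_le_one θ)
    calc |Real.cos (ν * θ)| * (|c k| * |Real.cos θ| ^ e k) ≤ 1 * (|c k| * 1) := by gcongr
      _ = |c k| := by ring

theorem hasSum_cosTransform_cos_mul_cos (a ν : ℝ) :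
    HasSum (fun k : ℕ => (-1) ^ k * a ^ (2 * k) / ((2 * k)! : ℝ) *
      cosTransform (fun θ => Real.cos θ ^ (2 * k)) ν)
      (cosTransform (fun θ => Real.cos (a * Real.cos θ)) ν) := by
  refine hasSum_cosTransform ?_ (fun θ => ?_) ν
  · exact (Real.hasSum_cos a).summable.abs
  · convert Real.hasSum_cos (a * Real.cos θ) using 2 with k
    rw [mul_pow]
    ring

theorem hasSum_cosTransform_sin_mul_cos (a ν : ℝ) :
    HasSum (fun k : ℕ => (-1) ^ k * a ^ (2 * k + 1) / ((2 * k + 1)! : ℝ) *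
      cosTransform (fun θ => Real.cos θ ^ (2 * k + 1)) ν)
      (cosTransform (fun θ => Real.sin (a * Real.cos θ)) ν) := by
  refine hasSum_cosTransform ?_ (fun θ => ?_) ν
  · exact (Real.hasSum_sin a).summable.abs
  · convert Real.hasSum_sin (a * Real.cos θ) using 2 with k
    rw [mul_pow]
    ring

theorem ascPochhammer_eval_ne_zero {x : ℝ} (hx : ∀ n : ℤ, x ≠ n) (k : ℕ) :
    (ascPochhammer ℝ k).eval x ≠ 0 := by
  induction k with
  | zero => simp
  | succ k ih =>
    rw [ascPochhammer_succ_eval]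
    refine mul_ne_zero ih fun h => hx (-k) ?_
    push_cast
    linarith

/-- The cosine transform of `cos (a cos θ)` is a Lommel function of index `-1`. Integer `ν` are
excluded: there the factor in front of `lommelS` may vanish while `lommelS` takes a junk value. -/
theorem cosTransform_cos_mul_cos {ν : ℝ} (hν : ∀ n : ℤ, ν ≠ n) (a : ℝ) :
    cosTransform (fun θ => Real.cos (a * Real.cos θ)) ν =
      -2 * (ν * Real.sin (Real.pi * ν / 2) * lommelS (-1) ν a) := by
  have h0 : ν ≠ 0 := by simpa using hν 0
  have hm := mul_cosTransform_cos_pow_zero ν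
  rw [← (hasSum_cosTransform_cos_mul_cos a ν).tsum_eq]
  have hI : cosTransform (fun θ => Real.cos θ ^ 0) ν = 2 * Real.sin (Real.pi * ν / 2) / ν := by
    rw [← hm]; field_simp
  have hterm : ∀ k : ℕ, (-1) ^ k * a ^ (2 * k) / ((2 * k)! : ℝ) *
      cosTransform (fun θ => Real.cos θ ^ (2 * k)) ν =
      cosTransform (fun θ => Real.cos θ ^ 0) ν * ((ascPochhammer ℝ k).eval 1 /
      ((ascPochhammer ℝ k).eval (1 - ν / 2) * (ascPochhammer ℝ k).eval (1 + ν / 2)) *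
        ((-(a ^ 2 / 4)) ^ k / (k ! : ℝ))) := by
    intro k
    have hk := ascPochhammer_mul_cosTransform_cos_pow_even ν k
    have n1 : (ascPochhammer ℝ k).eval (1 - ν / 2) ≠ 0 := ascPochhammer_eval_ne_zero
      (fun n h => hν (2 - 2 * n) (by push_cast; linarith)) k
    have n2 : (ascPochhammer ℝ k).eval (1 + ν / 2) ≠ 0 := ascPochhammer_eval_ne_zero
      (fun n h => hν (2 * n - 2) (by push_cast; linarith)) k
    have hfac : ((2 * k)! : ℝ) ≠ 0 := by positivity
    have hfac' : (k ! : ℝ) ≠ 0 := by positivity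
    rw [ascPochhammer_eval_one, neg_pow (a ^ 2 / 4), div_pow, ← pow_mul]
    generalize (ascPochhammer ℝ k).eval (1 - ν / 2) = p at *
    generalize (ascPochhammer ℝ k).eval (1 + ν / 2) = q at *
    generalize cosTransform (fun θ => Real.cos θ ^ 0) ν = I₀ at *
    field_simp
    linear_combination a ^ (2 * k) * hk
  simp_rw [hterm]
  rw [tsum_mul_left, hI, lommelS, hyp1F2, show (-1 - ν + 3) / 2 = 1 - ν / 2 by ring,
    show (-1 + ν + 3) / 2 = 1 + ν / 2 by ring, show (-1 : ℝ) + 1 = 0 by ring, Real.rpow_zero]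
  field_simp
  ring

/-- The cosine transform of `sin (a cos θ)` is a Lommel function of index `0`. -/
theorem cosTransform_sin_mul_cos {ν : ℝ} (hν : ∀ n : ℤ, ν ≠ n) (a : ℝ) :
    cosTransform (fun θ => Real.sin (a * Real.cos θ)) ν =
      2 * (Real.cos (Real.pi * ν / 2) * lommelS 0 ν a) := by
  have h0 : 1 - ν ^ 2 ≠ 0 := fun h => by
    have : (1 - ν) * (1 + ν) = 0 := by linear_combination h
    rcases mul_eq_zero.1 this with h | h
    · exact hν 1 (by push_cast; linarith)
    · exact hν (-1) (by push_cast; linarith)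
  have hm := mul_cosTransform_cos_pow_one ν
  rw [← (hasSum_cosTransform_sin_mul_cos a ν).tsum_eq]
  have hI : cosTransform (fun θ => Real.cos θ ^ 1) ν =
      2 * Real.cos (Real.pi * ν / 2) / (1 - ν ^ 2) := by
    rw [← hm]; field_simp
  have hterm : ∀ k : ℕ, (-1) ^ k * a ^ (2 * k + 1) / ((2 * k + 1)! : ℝ) *
      cosTransform (fun θ => Real.cos θ ^ (2 * k + 1)) ν =
      a * cosTransform (fun θ => Real.cos θ ^ 1) ν * ((ascPochhammer ℝ k).eval 1 /
      ((ascPochhammer ℝ k).eval ((3 - ν) / 2) * (ascPochhammer ℝ k).eval ((3 + ν) / 2)) *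
        ((-(a ^ 2 / 4)) ^ k / (k ! : ℝ))) := by
    intro k
    have hk := ascPochhammer_mul_cosTransform_cos_pow_odd ν k
    have n1 : (ascPochhammer ℝ k).eval ((3 - ν) / 2) ≠ 0 := ascPochhammer_eval_ne_zero
      (fun n h => hν (3 - 2 * n) (by push_cast; linarith)) k
    have n2 : (ascPochhammer ℝ k).eval ((3 + ν) / 2) ≠ 0 := ascPochhammer_eval_ne_zero
      (fun n h => hν (2 * n - 3) (by push_cast; linarith)) k
    have hfac : ((2 * k + 1)! : ℝ) ≠ 0 := by positivity
    have hfac' : (k ! : ℝ) ≠ 0 := by positivity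
    rw [ascPochhammer_eval_one, neg_pow (a ^ 2 / 4), div_pow, ← pow_mul, pow_succ a]
    generalize (ascPochhammer ℝ k).eval ((3 - ν) / 2) = p at *
    generalize (ascPochhammer ℝ k).eval ((3 + ν) / 2) = q at *
    generalize cosTransform (fun θ => Real.cos θ ^ 1) ν = I₁ at *
    field_simp
    linear_combination a * a ^ (2 * k) * hk
  simp_rw [hterm]
  rw [tsum_mul_left, hI, lommelS, hyp1F2, show (0 - ν + 3) / 2 = (3 - ν) / 2 by ring,
    show (0 + ν + 3) / 2 = (3 + ν) / 2 by ring, show (0 : ℝ) + 1 = 1 by ring, Real.rpow_one,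
    one_pow]
  field_simp

/-! ### Integral representations of `J₀` and `H₀` -/

/-- The expansion behind `cosTransform_cos_mul_cos`, taken at `ν = 0`. -/
theorem integral_cos_mul_cos (x : ℝ) :
    ∫ θ in (-(Real.pi / 2))..(Real.pi / 2), Real.cos (x * Real.cos θ) =
      Real.pi * besselJ0 x := by
  have h := hasSum_cosTransform_cos_mul_cos x 0
  have hI : cosTransform (fun θ => Real.cos θ ^ 0) 0 = Real.pi := by
    simp [cosTransform]
  have hl : cosTransform (fun θ => Real.cos (x * Real.cos θ)) 0 =
      ∫ θ in (-(Real.pi / 2))..(Real.pi / 2), Real.cos (x * Real.cos θ) := by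
    simp [cosTransform]
  rw [← hl, ← h.tsum_eq, besselJ0, ← tsum_mul_left]
  congr 1
  ext k
  have hk := ascPochhammer_mul_cosTransform_cos_pow_even 0 k
  rw [zero_div, sub_zero, add_zero, ascPochhammer_eval_one, hI] at hk
  have hfac : ((2 * k)! : ℝ) ≠ 0 := by positivity
  have hfac' : (k ! : ℝ) ≠ 0 := by positivity
  have h4 : (2 : ℝ) ^ (2 * k) = 4 ^ k := by rw [pow_mul]; norm_num
  rw [div_pow, h4]
  field_simp
  linear_combination x ^ (2 * k) * hk

theorem Gamma_nat_add_three_halves (k : ℕ) :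
    Real.Gamma (k + 3 / 2) = (ascPochhammer ℝ k).eval (3 / 2) * (√Real.pi / 2) := by
  induction k with
  | zero =>
    have := Real.Gamma_add_one (s := 1 / 2) (by norm_num)
    rw [Real.Gamma_one_half_eq] at this
    norm_num at this ⊢
    rw [this]; ring
  | succ k ih =>
    rw [Nat.cast_succ, show (k : ℝ) + 1 + 3 / 2 = (k + 3 / 2) + 1 by ring,
      Real.Gamma_add_one (by positivity), ih, ascPochhammer_succ_eval]
    ring

/-- The expansion behind `cosTransform_sin_mul_cos`, taken at `ν = 0`. -/
theorem integral_sin_mul_cos (x : ℝ) :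
    ∫ θ in (-(Real.pi / 2))..(Real.pi / 2), Real.sin (x * Real.cos θ) =
      Real.pi * struveH0 x := by
  have h := hasSum_cosTransform_sin_mul_cos x 0
  have hI : cosTransform (fun θ => Real.cos θ ^ 1) 0 = 2 := by
    simpa using mul_cosTransform_cos_pow_one 0
  have hl : cosTransform (fun θ => Real.sin (x * Real.cos θ)) 0 =
      ∫ θ in (-(Real.pi / 2))..(Real.pi / 2), Real.sin (x * Real.cos θ) := by
    simp [cosTransform]
  rw [← hl, ← h.tsum_eq, struveH0, ← tsum_mul_left]
  congr 1
  ext k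
  have hk := ascPochhammer_mul_cosTransform_cos_pow_odd 0 k
  rw [sub_zero, add_zero, hI] at hk
  have hfac : ((2 * k + 1)! : ℝ) ≠ 0 := by positivity
  have hp : (ascPochhammer ℝ k).eval ((3 : ℝ) / 2) ≠ 0 :=
    (ascPochhammer_pos k _ (by norm_num)).ne'
  have h4 : (2 : ℝ) ^ (2 * k + 1) = 2 * 4 ^ k := by rw [pow_succ, pow_mul]; norm_num; ring
  have hs : √Real.pi ^ 2 = Real.pi := Real.sq_sqrt Real.pi_pos.le
  rw [div_pow, h4, Gamma_nat_add_three_halves, mul_pow, div_pow, hs]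
  generalize (ascPochhammer ℝ k).eval ((3 : ℝ) / 2) = p at *
  have := Real.pi_ne_zero
  field_simp
  linear_combination x ^ (2 * k + 1) * hk

/-! ### The integrals of products of Lommel functions -/

theorem ae_forall_ne_intCast : ∀ᵐ x : ℝ ∂volume.restrict (Ioi 0), ∀ n : ℤ, x ≠ n := by
  have h : ∀ᵐ x : ℝ ∂volume.restrict (Ioi 0), x ∉ range ((↑) : ℤ → ℝ) :=
    (countable_range _).ae_notMem _
  filter_upwards [h] with x hx n hn
  exact hx ⟨n, hn.symm⟩

/-- Transfers an integral over `(0, ∞)` of a product of two cosine transforms to an integrand that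
agrees with a multiple of it away from the integers. -/
theorem integral_Ioi_of_eq_cosTransform {f g : ℝ → ℝ} {F : ℝ → ℝ} {c : ℝ} (hf : Continuous f)
    (hg : Continuous g) (hfe : ∀ θ, f (-θ) = f θ) (hge : ∀ θ, g (-θ) = g θ)
    (hF : ∀ x : ℝ, (∀ n : ℤ, x ≠ n) → F x = c * (cosTransform f x * cosTransform g x)) :
    IntegrableOn F (Ioi 0) ∧ ∫ x in Ioi (0 : ℝ), F x =
      c * (Real.pi * ∫ θ in (-(Real.pi / 2))..(Real.pi / 2), f θ * g θ) := by
  obtain ⟨h1, h2⟩ := integral_cosTransform_mul_cosTransform hf hg hfe hge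
  have h3 : F =ᵐ[volume.restrict (Ioi 0)]
      fun x => c * (cosTransform f x * cosTransform g x) := by
    filter_upwards [ae_forall_ne_intCast] with x hx
    exact hF x hx
  refine ⟨(h1.const_mul c).congr h3.symm, ?_⟩
  rw [integral_congr_ae h3, integral_const_mul, h2]

theorem besselJ0_abs (x : ℝ) : besselJ0 |x| = besselJ0 x := by
  simp only [besselJ0, pow_mul, div_pow, sq_abs]

theorem besselJ0_zero : besselJ0 0 = 1 := by
  have h := integral_cos_mul_cos 0
  simp only [zero_mul, Real.cos_zero, intervalIntegral.integral_const, smul_eq_mul,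
    mul_one] at h
  refine mul_left_cancel₀ Real.pi_ne_zero ?_
  rw [← h]
  ring

theorem struveH0_zero : struveH0 0 = 0 := by
  simp [struveH0]

theorem integral_cos_mul_sin_cos (a b : ℝ) :
    ∫ θ in (-(Real.pi / 2))..(Real.pi / 2),
      Real.cos (a * Real.cos θ) * Real.sin (b * Real.cos θ) =
      Real.pi / 2 * (struveH0 (a + b) - struveH0 (a - b)) := by
  have h : ∀ θ, Real.cos (a * Real.cos θ) * Real.sin (b * Real.cos θ) =
      2⁻¹ * (Real.sin ((a + b) * Real.cos θ) - Real.sin ((a - b) * Real.cos θ)) := fun θ => by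
    rw [add_mul, sub_mul, Real.sin_add, Real.sin_sub]; ring
  simp_rw [h]
  rw [intervalIntegral.integral_const_mul, intervalIntegral.integral_sub
    (Continuous.intervalIntegrable (by fun_prop) _ _)
    (Continuous.intervalIntegrable (by fun_prop) _ _), integral_sin_mul_cos, integral_sin_mul_cos]
  ring

theorem integral_sin_mul_sin_cos (a b : ℝ) :
    ∫ θ in (-(Real.pi / 2))..(Real.pi / 2),
      Real.sin (a * Real.cos θ) * Real.sin (b * Real.cos θ) =
      Real.pi / 2 * (besselJ0 (a - b) - besselJ0 (a + b)) := by
  have h : ∀ θ, Real.sin (a * Real.cos θ) * Real.sin (b * Real.cos θ) =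
      2⁻¹ * (Real.cos ((a - b) * Real.cos θ) - Real.cos ((a + b) * Real.cos θ)) := fun θ => by
    rw [add_mul, sub_mul, Real.cos_add, Real.cos_sub]; ring
  simp_rw [h]
  rw [intervalIntegral.integral_const_mul, intervalIntegral.integral_sub
    (Continuous.intervalIntegrable (by fun_prop) _ _)
    (Continuous.intervalIntegrable (by fun_prop) _ _), integral_cos_mul_cos, integral_cos_mul_cos]
  ring

theorem integral_cos_mul_cos_cos (a b : ℝ) :
    ∫ θ in (-(Real.pi / 2))..(Real.pi / 2),
      Real.cos (a * Real.cos θ) * Real.cos (b * Real.cos θ) =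
      Real.pi / 2 * (besselJ0 (a - b) + besselJ0 (a + b)) := by
  have h : ∀ θ, Real.cos (a * Real.cos θ) * Real.cos (b * Real.cos θ) =
      2⁻¹ * (Real.cos ((a - b) * Real.cos θ) + Real.cos ((a + b) * Real.cos θ)) := fun θ => by
    rw [add_mul, sub_mul, Real.cos_add, Real.cos_sub]; ring
  simp_rw [h]
  rw [intervalIntegral.integral_const_mul, intervalIntegral.integral_add
    (Continuous.intervalIntegrable (by fun_prop) _ _)
    (Continuous.intervalIntegrable (by fun_prop) _ _), integral_cos_mul_cos, integral_cos_mul_cos]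
  ring

theorem integral_lommelS_neg_one_mul_lommelS_zero (a b : ℝ) :
    IntegrableOn (fun x : ℝ => x * Real.sin (Real.pi * x) * lommelS (-1) x a * lommelS 0 x b)
        (Ioi 0) ∧
      ∫ x in Ioi (0 : ℝ), x * Real.sin (Real.pi * x) * lommelS (-1) x a * lommelS 0 x b =
        Real.pi ^ 2 / 4 * (struveH0 (a - b) - struveH0 (a + b)) := by
  obtain ⟨h1, h2⟩ := integral_Ioi_of_eq_cosTransform (c := -(1 / 2))
    (f := fun θ => Real.cos (a * Real.cos θ)) (g := fun θ => Real.sin (b * Real.cos θ))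
    (F := fun x : ℝ => x * Real.sin (Real.pi * x) * lommelS (-1) x a * lommelS 0 x b)
    (by fun_prop) (by fun_prop) (by simp) (by simp) (fun x hx => by
      rw [cosTransform_cos_mul_cos hx, cosTransform_sin_mul_cos hx,
        show Real.pi * x = 2 * (Real.pi * x / 2) by ring, Real.sin_two_mul,
        show 2 * (Real.pi * x / 2) / 2 = Real.pi * x / 2 by ring]
      ring)
  refine ⟨h1, h2.trans ?_⟩
  rw [integral_cos_mul_sin_cos]
  ring

theorem integral_lommelS_zero_mul_lommelS_zero (a b : ℝ) :
    IntegrableOn (fun x : ℝ => Real.cos (Real.pi * x / 2) ^ 2 * lommelS 0 x a * lommelS 0 x b)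
        (Ioi 0) ∧
      ∫ x in Ioi (0 : ℝ), Real.cos (Real.pi * x / 2) ^ 2 * lommelS 0 x a * lommelS 0 x b =
        Real.pi ^ 2 / 8 * (besselJ0 |a - b| - besselJ0 (a + b)) := by
  obtain ⟨h1, h2⟩ := integral_Ioi_of_eq_cosTransform (c := 1 / 4)
    (f := fun θ => Real.sin (a * Real.cos θ)) (g := fun θ => Real.sin (b * Real.cos θ))
    (F := fun x : ℝ => Real.cos (Real.pi * x / 2) ^ 2 * lommelS 0 x a * lommelS 0 x b)
    (by fun_prop) (by fun_prop) (by simp) (by simp) (fun x hx => by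
      rw [cosTransform_sin_mul_cos hx, cosTransform_sin_mul_cos hx]
      ring)
  refine ⟨h1, h2.trans ?_⟩
  rw [integral_sin_mul_sin_cos, besselJ0_abs]
  ring

theorem integral_lommelS_neg_one_mul_lommelS_neg_one (a b : ℝ) :
    IntegrableOn
        (fun x : ℝ => x ^ 2 * Real.sin (Real.pi * x / 2) ^ 2 * lommelS (-1) x a * lommelS (-1) x b)
        (Ioi 0) ∧
      ∫ x in Ioi (0 : ℝ),
          x ^ 2 * Real.sin (Real.pi * x / 2) ^ 2 * lommelS (-1) x a * lommelS (-1) x b =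
        Real.pi ^ 2 / 8 * (besselJ0 |a - b| + besselJ0 (a + b)) := by
  obtain ⟨h1, h2⟩ := integral_Ioi_of_eq_cosTransform (c := 1 / 4)
    (f := fun θ => Real.cos (a * Real.cos θ)) (g := fun θ => Real.cos (b * Real.cos θ))
    (F := fun x : ℝ =>
      x ^ 2 * Real.sin (Real.pi * x / 2) ^ 2 * lommelS (-1) x a * lommelS (-1) x b)
    (by fun_prop) (by fun_prop) (by simp) (by simp) (fun x hx => by
      rw [cosTransform_cos_mul_cos hx, cosTransform_cos_mul_cos hx]
      ring)
  refine ⟨h1, h2.trans ?_⟩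
  rw [integral_cos_mul_cos_cos, besselJ0_abs]
  ring

theorem theorem1 :
    -- (a)
    (∀ a b : ℝ,
      IntegrableOn (fun x : ℝ => x * Real.sin (Real.pi * x) * lommelS (-1) x a * lommelS 0 x b)
        (Ioi 0) ∧
      ∫ x in Ioi (0 : ℝ), x * Real.sin (Real.pi * x) * lommelS (-1) x a * lommelS 0 x b =
        Real.pi ^ 2 / 4 * (struveH0 (a - b) - struveH0 (a + b))) ∧
    -- (a')
    (∀ a : ℝ,
      IntegrableOn (fun x : ℝ => x * Real.sin (Real.pi * x) * lommelS (-1) x a * lommelS 0 x a)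
        (Ioi 0) ∧
      ∫ x in Ioi (0 : ℝ), x * Real.sin (Real.pi * x) * lommelS (-1) x a * lommelS 0 x a =
        -(Real.pi ^ 2 / 4) * struveH0 (2 * a)) ∧
    -- (b)
    (∀ a b : ℝ,
      IntegrableOn (fun x : ℝ => Real.cos (Real.pi * x / 2) ^ 2 * lommelS 0 x a * lommelS 0 x b)
        (Ioi 0) ∧
      ∫ x in Ioi (0 : ℝ), Real.cos (Real.pi * x / 2) ^ 2 * lommelS 0 x a * lommelS 0 x b =
        Real.pi ^ 2 / 8 * (besselJ0 |a - b| - besselJ0 (a + b))) ∧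
    -- (b')
    (∀ a : ℝ,
      IntegrableOn (fun x : ℝ => Real.cos (Real.pi * x / 2) ^ 2 * lommelS 0 x a ^ 2) (Ioi 0) ∧
      ∫ x in Ioi (0 : ℝ), Real.cos (Real.pi * x / 2) ^ 2 * lommelS 0 x a ^ 2 =
        Real.pi ^ 2 / 8 * (1 - besselJ0 (2 * a))) ∧
    -- (c)
    (∀ a b : ℝ,
      IntegrableOn
        (fun x : ℝ => x ^ 2 * Real.sin (Real.pi * x / 2) ^ 2 * lommelS (-1) x a * lommelS (-1) x b)
        (Ioi 0) ∧
      ∫ x in Ioi (0 : ℝ),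
          x ^ 2 * Real.sin (Real.pi * x / 2) ^ 2 * lommelS (-1) x a * lommelS (-1) x b =
        Real.pi ^ 2 / 8 * (besselJ0 |a - b| + besselJ0 (a + b))) ∧
    -- (c')
    (∀ a : ℝ,
      IntegrableOn
        (fun x : ℝ => x ^ 2 * Real.sin (Real.pi * x / 2) ^ 2 * lommelS (-1) x a ^ 2) (Ioi 0) ∧
      ∫ x in Ioi (0 : ℝ), x ^ 2 * Real.sin (Real.pi * x / 2) ^ 2 * lommelS (-1) x a ^ 2 =
        Real.pi ^ 2 / 8 * (1 + besselJ0 (2 * a))) := by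
  refine ⟨integral_lommelS_neg_one_mul_lommelS_zero, fun a => ?_,
    integral_lommelS_zero_mul_lommelS_zero, fun a => ?_,
    integral_lommelS_neg_one_mul_lommelS_neg_one, fun a => ?_⟩
  · obtain ⟨h1, h2⟩ := integral_lommelS_neg_one_mul_lommelS_zero a a
    refine ⟨h1, h2.trans ?_⟩
    rw [sub_self, struveH0_zero, two_mul]
    ring
  · obtain ⟨h1, h2⟩ := integral_lommelS_zero_mul_lommelS_zero a a
    simp only [mul_assoc, ← sq] at h1 h2
    refine ⟨h1, h2.trans ?_⟩
    rw [sub_self, abs_zero, besselJ0_zero, two_mul]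
  · obtain ⟨h1, h2⟩ := integral_lommelS_neg_one_mul_lommelS_neg_one a a
    simp only [mul_assoc, ← sq (lommelS _ _ _)] at h1 h2 ⊢
    refine ⟨h1, h2.trans ?_⟩
    rw [sub_self, abs_zero, besselJ0_zero, two_mul]
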